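/- **Proto-algorithms.** An alphabet $\Sigma=(F,P)$ consists of disjoint countable sets $F$ (function symbols) and $P$ (predicate symbols) with two distinct distinguished symbols $\mathit{ini},\mathit{fin}\in F$; put $\widetilde F=F\setminus\{\mathit{ini},\mathit{fin}\}$. A $\Sigma$-algorithm graph $G=(V,E,l,r)$ is a finite directed graph ($E\subseteq V\times V$) with root $r$, in which each vertex $v$ has a label $l(v)\in F\cup P$ and some edges have a label in $\{0,1\}$, such that: $l(v)=\mathit{ini}$ iff $v=r$; the root has indegree $0$; all other vertices have positive indegree; vertices labeled $\mathit{fin}$ have outdegree $0$; vertices with a label in $F\setminus\{\mathit{fin}\}$ have outdegree $1$ and their outgoing edge is unlabeled; vertices with a label in $P$ have outdegree $2$ and their two outgoing edges are labeled, differently; and every cycle contains a vertex with a label in $F$. A $\Sigma$-interpretation $\mathcal I=(D,D_{\mathrm{in}},D_{\mathrm{out}},I)$ consists of sets and total functions $I(\mathit{ini}):D_{\mathrm{in}}\to D$, $I(\mathit{fin}):D\to D_{\mathrm{out}}$, $I(o):D\to D$ ($o\in\widetilde F$), $I(p):D\to\{0,1\}$ ($p\in P$), such that no proper subset of $D$ contains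 all $I(\mathit{ini})(d)$ and is closed under all $I(o)$, $o\in\widetilde F$. A proto-algorithm is a triple $A=(\Sigma,G,\mathcal I)$. Its step function $\mathrm{astep}_A$ acts on the disjoint union of $D_{\mathrm{in}}$, $V\times D$ and $D_{\mathrm{out}}$: an input $d$ goes to $(v',I(\mathit{ini})(d))$ with $(r,v')\in E$; $(v,d)$ goes to $(v',I(o)(d))$ with $(v,v')\in E$ if $l(v)=o\in\widetilde F$, to $(v',d)$ with $(v,v')\in E$ and $l(v,v')=I(p)(d)$ if $l(v)=p\in P$, and to the output $I(\mathit{fin})(d)$ if $l(v)=\mathit{fin}$; outputs and the (unreachable) states $(r,d)$ are fixed. $A$ is algorithmically simulated by $A'$ if there is a relation $R\subseteq(D_{\mathrm{in}}\times D'_{\mathrm{in}})\cup((V\times D)\times(V'\times D'))\cup(D_{\mathrm{out}}\times D'_{\mathrm{out}})$ relating each $d\in D_{\mathrm{in}}$ to exactly one $d'\in D'_{\mathrm{in}}$, each $d'\in D'_{\mathrm{out}}$ to exactly one $d\in D_{\mathrm{out}}$, and closed under $(s,s')\mapsto(\mathrm{astep}_A(s),\mathrm{astep}_{A'}(s'))$.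 $A$ and $A'$ are algorithmically equivalent if each is algorithmically simulated by the other. **The process algebra.** Fix $\Sigma$ and $\mathcal I$. Let $\mathfrak D$ be an algebra with carriers $D\cup D_{\mathrm{in}}\cup D_{\mathrm{out}}$ (sort Data) and $\{0,1\}$ (sort Bool), with the members of $D_{\mathrm{in}}$ and the bits $0,1$ as constants, and with the symbols in $F$ and $P$ as operators $\mathrm{Data}\to\mathrm{Data}$ and $\mathrm{Data}\to\mathrm{Bool}$ interpreted by any extensions to the whole carrier of the functions given by $I$. Let $\mathcal V$ be a countable set of flexible variables with $m\in\mathcal V$, let $\mathsf{Act}$ be a finite set of basic actions and $\mathcal X$ a countably infinite set of process variables. Data terms are built from data constants, flexible variables and operators; conditions from equations between terms of sort Data or of sort Bool, $\mathsf T,\mathsf F,\neg,\wedge,\vee,\Rightarrow$; process terms from process variables, basic actions $a$, $\delta$, $\epsilon$, $x+y$, $x\cdot y$, assignments $v:=e$, guarded commands $\phi:\to x$, and evaluations $\mathsf V_\rho(x)$, where $\rho$ maps flexible variables to closed data terms without flexible variables. Linear terms are $\delta$, $\phi:\to\epsilon$, $\phi:\to\alpha\cdot X$ ($\alpha$ a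 basic action or an assignment) and sums of linear terms other than $\delta$. For each linear recursive specification $S=\{X=t_X\}$ and each variable $X$ of $S$ there is a constant $\langle X|S\rangle$. Write $\vdash t=t'$ if $t=t'$ is derivable in (conditional) equational logic from A1–A9: $x+y=y+x$, $(x+y)+z=x+(y+z)$, $x+x=x$, $(x+y)\cdot z=x\cdot z+y\cdot z$, $(x\cdot y)\cdot z=x\cdot(y\cdot z)$, $x+\delta=x$, $\delta\cdot x=\delta$, $x\cdot\epsilon=x$, $\epsilon\cdot x=x$; GC1–GC7: $\mathsf T:\to x=x$, $\mathsf F:\to x=\delta$, $\phi:\to\delta=\delta$, $\phi:\to(x+y)=(\phi:\to x)+(\phi:\to y)$, $\phi:\to(x\cdot y)=(\phi:\to x)\cdot y$, $\phi:\to(\psi:\to x)=(\phi\wedge\psi):\to x$, $(\phi\vee\psi):\to x=(\phi:\to x)+(\psi:\to x)$; V1–V5: $\mathsf V_\rho(\epsilon)=\epsilon$, $\mathsf V_\rho(a\cdot x)=a\cdot\mathsf V_\rho(x)$, $\mathsf V_\rho((v:=e)\cdot x)=(v:=\rho(e))\cdot\mathsf V_{\rho[v\mapsto\rho(e)]}(x)$,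 $\mathsf V_\rho(x+y)=\mathsf V_\rho(x)+\mathsf V_\rho(y)$, $\mathsf V_\rho(\phi:\to x)=\rho(\phi):\to\mathsf V_\rho(x)$; IMP1–IMP2: $e=e'$ if $\mathfrak D\models e=e'$, and $\phi=\psi$ if $\mathfrak D\models\phi\Leftrightarrow\psi$ (flexible variables read as variables); RDP: $\langle X|S\rangle$ equals $t_X$ with each variable $Y$ of $S$ replaced by $\langle Y|S\rangle$; RSP: if the equations of $S$ hold, then $X=\langle X|S\rangle$. **Graph-to-process function.** For a $\Sigma$-algorithm graph $G$, let $X_\epsilon$ and $X_v$ ($v\in V$) be distinct process variables. Then $\mathrm{proc}(G)=\langle X_r|S\rangle$ (unique up to renaming of variables), where $S$ has exactly the equations $X_v=\mathsf T:\to(m:=o(m))\cdot X_{v'}$ if $l(v)=o\in F\setminus\{\mathit{fin}\}$ and $(v,v')\in E$ (this includes $v=r$, $o=\mathit{ini}$); $X_v=(p(m)=1):\to(m:=m)\cdot X_{v'}+(p(m)=0):\to(m:=m)\cdot X_{v''}$ if $l(v)=p\in P$, $(v,v'),(v,v'')\in E$, $l(v,v')=1$, $l(v,v'')=0$; $X_v=\mathsf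 T:\to(m:=\mathit{fin}(m))\cdot X_\epsilon$ if $l(v)=\mathit{fin}$; and $X_\epsilon=\mathsf T:\to\epsilon$. **Theorem.** Let $A=(\Sigma,G,\mathcal I)$ and $A'=(\Sigma,G',\mathcal I)$ be proto-algorithms with the same alphabet and interpretation, and for each $d\in D_{\mathrm{in}}$ let $[m\mapsto d]$ be a fixed but arbitrary valuation that maps $m$ to a term denoting $d$ in $\mathfrak D$. If, for all $d\in D_{\mathrm{in}}$, $\vdash\mathsf V_{[m\mapsto d]}(\mathrm{proc}(G))=\mathsf V_{[m\mapsto d]}(\mathrm{proc}(G'))$, then $A$ and $A'$ are algorithmically equivalent. -/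

import Mathlib

set_option linter.checkUnivs false

universe u v w u' v' w' a b

/-! ## Proto-algorithms -/

/-- An alphabet: countable sets `F` of function symbols and `P` of predicate symbols
(disjoint, since they are separate types) with two distinguished function symbols. -/
structure Alphabet where
  F : Type u
  P : Type u
  countable_F : Countable F
  countable_P : Countable P
  ini : F
  fin : F
  ini_ne_fin : ini ≠ fin

/-- The function symbols other than `ini` and `fin`. -/
def Alphabet.Op (Al : Alphabet.{u}) : Type u := {f : Al.F // f ≠ Al.ini ∧ f ≠ Al.fin}

/-- A rooted labeled directed graph with vertex labels from `Lv` and edge labels from `Le`.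
The partial labeling function is given by its parts on vertices and on edges
(`none` means undefined; pairs that are not edges are not labeled). -/
structure LGraph (Lv : Type u) (Le : Type w) where
  V : Type v
  finite_V : Finite V
  E : V → V → Prop
  vlabel : V → Option Lv
  elabel : V → V → Option Le
  elabel_dom : ∀ x y, elabel x y ≠ none → E x y
  root : V

namespace LGraph

variable {Lv : Type u} {Le : Type w} (G : LGraph.{u, v, w} Lv Le)

noncomputable def indeg (x : G.V) : ℕ := Set.ncard {y | G.E y x}

noncomputable def outdeg (x : G.V) : ℕ := Set.ncard {y | G.E x y}

/-- `c 0, …, c n` is a cycle: consecutive vertices are joined by edges, the first `n ≥ 1` vertices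
are distinct, and the last vertex equals the first. -/
def IsCycle {n : ℕ} (c : Fin (n + 1) → G.V) : Prop :=
  0 < n ∧ (∀ i : Fin n, G.E (c i.castSucc) (c i.succ)) ∧
    Function.Injective (fun i : Fin n => c i.castSucc) ∧ c 0 = c (Fin.last n)

end LGraph

/-- An algorithm graph over an alphabet. Edge labels are `0 = false` and `1 = true`. -/
structure AlgGraph (Al : Alphabet.{u}) extends LGraph.{u, v, 0} (Al.F ⊕ Al.P) Bool where
  labeled : ∀ x, vlabel x ≠ none
  ini_iff : ∀ x, vlabel x = some (Sum.inl Al.ini) ↔ x = root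
  ini_deg : ∀ x, vlabel x = some (Sum.inl Al.ini) →
    toLGraph.indeg x = 0 ∧ toLGraph.outdeg x = 1 ∧ ∀ y, E x y → elabel x y = none
  fin_deg : ∀ x, vlabel x = some (Sum.inl Al.fin) →
    0 < toLGraph.indeg x ∧ toLGraph.outdeg x = 0
  op_deg : ∀ x (o : Al.Op), vlabel x = some (Sum.inl o.1) →
    0 < toLGraph.indeg x ∧ toLGraph.outdeg x = 1 ∧ ∀ y, E x y → elabel x y = none
  pred_deg : ∀ x (p : Al.P), vlabel x = some (Sum.inr p) →
    0 < toLGraph.indeg x ∧ toLGraph.outdeg x = 2 ∧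
      ∀ y z, y ≠ z → E x y → E x z →
        elabel x y ≠ none ∧ elabel x z ≠ none ∧ elabel x y ≠ elabel x z
  cycle : ∀ (n : ℕ) (c : Fin (n + 1) → V), toLGraph.IsCycle c →
    ∃ (i : Fin n) (f : Al.F), vlabel (c i.castSucc) = some (Sum.inl f)

/-- An interpretation of an alphabet; the three domains are arbitrary, possibly overlapping,
sets of objects from `U`, and the functions are arbitrary total functions (computability over an
arbitrary set has no meaning without an encoding, and all computable functions are covered). -/
structure Interp (Al : Alphabet.{u}) (U : Type w) where
  D : Set U
  Din : Set U
  Dout : Set U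
  ini : Din → D
  fin : D → Dout
  op : Al.Op → D → D
  pred : Al.P → D → Bool
  minimal : ¬ ∃ D' : Set U, D' ⊂ D ∧ (∀ d : Din, (ini d : U) ∈ D') ∧
    ∀ (o : Al.Op) (d : D), (d : U) ∈ D' → (op o d : U) ∈ D'

structure ProtoAlg (U : Type w) where
  Al : Alphabet.{u}
  G : AlgGraph.{u, v} Al
  I : Interp Al U

/-! ## Algorithmic steps and algorithmic equivalence -/

namespace ProtoAlg

/-- The states: input states, internal states and output states (a disjoint union). -/
inductive State {U : Type w} (A : ProtoAlg.{u, v, w} U) where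
  | inp (d : A.I.Din) : State A
  | int (x : A.G.V) (d : A.I.D) : State A
  | out (d : A.I.Dout) : State A

/-- The clauses of the definition of the algorithmic step function, as a relation. -/
inductive Step {U : Type w} (A : ProtoAlg.{u, v, w} U) : A.State → A.State → Prop
  | inp (d : A.I.Din) (y : A.G.V) : A.G.E A.G.root y →
      Step A (.inp d) (.int y (A.I.ini d))
  | op (x y : A.G.V) (d : A.I.D) (o : A.Al.Op) :
      A.G.vlabel x = some (Sum.inl o.1) → A.G.E x y →
      Step A (.int x d) (.int y (A.I.op o d))
  | pred (x y : A.G.V) (d : A.I.D) (p : A.Al.P) :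
      A.G.vlabel x = some (Sum.inr p) → A.G.E x y → A.G.elabel x y = some (A.I.pred p d) →
      Step A (.int x d) (.int y d)
  | fin (x : A.G.V) (d : A.I.D) : A.G.vlabel x = some (Sum.inl A.Al.fin) →
      Step A (.int x d) (.out (A.I.fin d))
  | out (d : A.I.Dout) : Step A (.out d) (.out d)


theorem Step.unique {U : Type w} {A : ProtoAlg.{u, v, w} U} {s t t' : A.State}
    (h : Step A s t) (h' : Step A s t') : t = t' := by
  have hdeg : ∀ (x y y' : A.G.V), A.G.outdeg x = 1 → A.G.E x y → A.G.E x y' → y = y' := by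
    intro x y y' hx hy hy'
    obtain ⟨z, hz⟩ := Set.ncard_eq_one.1 hx
    have h1 : y ∈ ({z} : Set A.G.V) := hz ▸ hy
    have h2 : y' ∈ ({z} : Set A.G.V) := hz ▸ hy'
    exact (Set.mem_singleton_iff.1 h1).trans (Set.mem_singleton_iff.1 h2).symm
  cases h with
  | inp d y hy =>
    cases h' with
    | inp _ y' hy' =>
      rw [hdeg _ y y' (A.G.ini_deg _ ((A.G.ini_iff _).2 rfl)).2.1 hy hy']
  | op x y d o ho hy =>
    cases h' with
    | op _ y' _ o' ho' hy' =>
      have : o = o' := Subtype.ext (by simpa [ho] using ho')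
      subst this
      rw [hdeg _ y y' (A.G.op_deg _ _ ho).2.1 hy hy']
    | pred _ _ _ p hp => simp [ho] at hp
    | fin _ _ hf => exact absurd (by simpa [ho] using hf) o.2.2
  | pred x y d p hp hy hl =>
    cases h' with
    | op _ _ _ o ho => simp [hp] at ho
    | pred _ y' _ p' hp' hy' hl' =>
      have : p = p' := by simpa [hp] using hp'
      subst this
      by_cases hyy : y = y'
      · rw [hyy]
      · exact absurd (hl.trans hl'.symm) ((A.G.pred_deg _ _ hp).2.2 y y' hyy hy hy').2.2
    | fin _ _ hf => simp [hp] at hf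
  | fin x d hf =>
    cases h' with
    | op _ _ _ o ho => exact absurd (by simpa [hf] using ho.symm) o.2.2
    | pred _ _ _ p hp => simp [hf] at hp
    | fin => rfl
  | out d => cases h'; rfl

theorem Step.exists {U : Type w} {A : ProtoAlg.{u, v, w} U} (s : A.State)
    (hs : ∀ d, s ≠ .int A.G.root d) : ∃ t, Step A s t := by
  have hdeg : ∀ (x : A.G.V), A.G.outdeg x = 1 → ∃ y, A.G.E x y := by
    intro x hx
    obtain ⟨z, hz⟩ := Set.ncard_eq_one.1 hx
    exact ⟨z, (Set.ext_iff.1 hz z).2 rfl⟩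
  cases s with
  | inp d =>
    obtain ⟨y, hy⟩ := hdeg _ (A.G.ini_deg _ ((A.G.ini_iff _).2 rfl)).2.1
    exact ⟨_, .inp d y hy⟩
  | out d => exact ⟨_, .out d⟩
  | int x d =>
    obtain ⟨l, hl⟩ := Option.ne_none_iff_exists'.1 (A.G.labeled x)
    rcases l with f | p
    · by_cases hf : f = A.Al.fin
      · exact ⟨_, .fin x d (hf ▸ hl)⟩
      · by_cases hi : f = A.Al.ini
        · exact absurd (by rw [(A.G.ini_iff x).1 (hi ▸ hl)]) (hs d)
        · obtain ⟨y, hy⟩ := hdeg _ (A.G.op_deg x ⟨f, hi, hf⟩ hl).2.1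
          exact ⟨_, .op x y d ⟨f, hi, hf⟩ hl hy⟩
    · obtain ⟨-, h2, h3⟩ := A.G.pred_deg x p hl
      obtain ⟨y, z, hyz, hE⟩ := Set.ncard_eq_two.1 h2
      have hy : A.G.E x y := (Set.ext_iff.1 hE y).2 (by simp)
      have hz : A.G.E x z := (Set.ext_iff.1 hE z).2 (by simp)
      obtain ⟨h4, h5, h6⟩ := h3 y z hyz hy hz
      obtain ⟨b, hb⟩ := Option.ne_none_iff_exists'.1 h4
      obtain ⟨c, hc⟩ := Option.ne_none_iff_exists'.1 h5
      by_cases hbp : b = A.I.pred p d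
      · exact ⟨_, .pred x y d p hl hy (hbp ▸ hb)⟩
      · have hbc : b ≠ c := fun h => h6 (by rw [hb, hc, h])
        have : c = A.I.pred p d := by
          cases b <;> cases c <;> cases h : A.I.pred p d <;> simp_all
        exact ⟨_, .pred x z d p hl hz (this ▸ hc)⟩

open Classical in
/-- The algorithmic step function. The internal states at the root, for which there is no clause
and which cannot be reached, are left unchanged. -/
noncomputable def astep {U : Type w} (A : ProtoAlg.{u, v, w} U) (s : A.State) : A.State :=
  if h : ∃ t, Step A s t then h.choose else s

theorem astep_eq {U : Type w} {A : ProtoAlg.{u, v, w} U} {s t : A.State} (h : Step A s t) :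
    A.astep s = t := by
  have h' : ∃ t, Step A s t := ⟨t, h⟩
  rw [astep, dif_pos h']
  exact h'.choose_spec.unique h

/-- Two states (of possibly different proto-algorithms) are both input states, both internal states
or both output states. -/
def State.SameKind {U : Type w} {U' : Type w'} {A : ProtoAlg.{u, v, w} U}
    {A' : ProtoAlg.{u', v', w'} U'} : A.State → A'.State → Prop
  | .inp _, .inp _ => True
  | .int _ _, .int _ _ => True
  | .out _, .out _ => True
  | _, _ => False

/-- Algorithmic simulations of `A` by `A'`. -/
structure IsAlgSimulation {U : Type w} {U' : Type w'} (A : ProtoAlg.{u, v, w} U)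
    (A' : ProtoAlg.{u', v', w'} U') (R : A.State → A'.State → Prop) : Prop where
  sameKind : ∀ s s', R s s' → s.SameKind s'
  inp : ∀ d : A.I.Din, ∃! d' : A'.I.Din, R (.inp d) (.inp d')
  out : ∀ d' : A'.I.Dout, ∃! d : A.I.Dout, R (.out d) (.out d')
  step : ∀ s s', R s s' → R (A.astep s) (A'.astep s')

/-- `A` is algorithmically simulated by `A'`. -/
def AlgSimulated {U : Type w} {U' : Type w'} (A : ProtoAlg.{u, v, w} U)
    (A' : ProtoAlg.{u', v', w'} U') : Prop :=
  ∃ R : A.State → A'.State → Prop, IsAlgSimulation A A' R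

/-- `A` is algorithmically equivalent to `A'`. -/
def AlgEquivalent {U : Type w} {U' : Type w'} (A : ProtoAlg.{u, v, w} U)
    (A' : ProtoAlg.{u', v', w'} U') : Prop :=
  AlgSimulated A A' ∧ AlgSimulated A' A

end ProtoAlg

/-! ## Data

The data signature of an alphabet with a set `C` of constants has sorts `Data` and `Bool`,
the constants `C` of sort `Data`, an operator from `Data` to `Data` for each function symbol, the
constants `0` and `1` of sort `Bool`, and an operator from `Data` to `Bool` for each predicate
symbol. Terms over it may also contain flexible variables from `W` as constants of sort `Data`. -/

/-- Terms of sort `Data` with flexible variables from `W`. -/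
inductive DTerm (Al : Alphabet.{u}) (C : Type w) (W : Type b) where
  | flex (x : W)
  | const (c : C)
  | app (f : Al.F) (e : DTerm Al C W)

/-- Terms of sort `Bool`. -/
inductive BTerm (Al : Alphabet.{u}) (C : Type w) (W : Type b) where
  | zero
  | one
  | app (p : Al.P) (e : DTerm Al C W)

/-- Terms of sort `Cond`. -/
inductive CTerm (Al : Alphabet.{u}) (C : Type w) (W : Type b) where
  | eqB (t t' : BTerm Al C W)
  | eqD (e e' : DTerm Al C W)
  | tt
  | ff
  | not (φ : CTerm Al C W)
  | and (φ ψ : CTerm Al C W)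
  | or (φ ψ : CTerm Al C W)
  | imp (φ ψ : CTerm Al C W)

/-- The condition `φ ⇔ ψ`. -/
def CTerm.iff {Al : Alphabet.{u}} {C : Type w} {W : Type b} (φ ψ : CTerm Al C W) : CTerm Al C W :=
  .and (.imp φ ψ) (.imp ψ φ)

/-- Data values: closed terms of sort `Data` over the data signature, without flexible variables. -/
abbrev DVal (Al : Alphabet.{u}) (C : Type w) := DTerm Al C Empty

/-- Flexible variable valuations. -/
abbrev FVal (Al : Alphabet.{u}) (C : Type w) (W : Type b) := W → DVal Al C

/-- A data value is in particular a term with flexible variables. -/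
def DTerm.lift {Al : Alphabet.{u}} {C : Type w} (W : Type b) : DVal Al C → DTerm Al C W
  | .const c => .const c
  | .app f e => .app f (e.lift W)

/-- The homomorphic extension of a flexible variable valuation to terms of sort `Data`. -/
def DTerm.val {Al : Alphabet.{u}} {C : Type w} {W : Type b} (ρ : FVal Al C W) :
    DTerm Al C W → DVal Al C
  | .flex x => ρ x
  | .const c => .const c
  | .app f e => .app f (e.val ρ)

/-- The homomorphic extension to terms of sort `Bool`. -/
def BTerm.val {Al : Alphabet.{u}} {C : Type w} {W : Type b} (ρ : FVal Al C W) :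
    BTerm Al C W → BTerm Al C W
  | .zero => .zero
  | .one => .one
  | .app p e => .app p ((e.val ρ).lift W)

/-- The homomorphic extension to terms of sort `Cond`. -/
def CTerm.val {Al : Alphabet.{u}} {C : Type w} {W : Type b} (ρ : FVal Al C W) :
    CTerm Al C W → CTerm Al C W
  | .eqB t t' => .eqB (t.val ρ) (t'.val ρ)
  | .eqD e e' => .eqD ((e.val ρ).lift W) ((e'.val ρ).lift W)
  | .tt => .tt
  | .ff => .ff
  | .not φ => .not (φ.val ρ)
  | .and φ ψ => .and (φ.val ρ) (ψ.val ρ)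
  | .or φ ψ => .or (φ.val ρ) (ψ.val ρ)
  | .imp φ ψ => .imp (φ.val ρ) (ψ.val ρ)

open Classical in
/-- The valuation `ρ` updated to take the value `e` at `x`. -/
noncomputable def FVal.upd {Al : Alphabet.{u}} {C : Type w} {W : Type b} (ρ : FVal Al C W) (x : W)
    (e : DVal Al C) : FVal Al C W :=
  Function.update ρ x e

/-- The carrier of sort `Data`. -/
abbrev Interp.Carrier {Al : Alphabet.{u}} {U : Type w} (I : Interp Al U) : Type w :=
  ↥(I.D ∪ I.Din ∪ I.Dout)

/-- A data algebra obtained from an interpretation: the carrier of sort `Data` is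
`D ∪ Din ∪ Dout`, the carrier of sort `Bool` is `{0, 1}`, the constants are the members of `Din`
(each denoting itself), and the function and predicate symbols denote arbitrary extensions to the
whole carrier of the functions assigned to them by the interpretation. Minimal algebras of this
kind are included. -/
structure DataAlgebra {Al : Alphabet.{u}} {U : Type w} (I : Interp Al U) where
  fn : Al.F → I.Carrier → I.Carrier
  pr : Al.P → I.Carrier → Bool
  fn_ini : ∀ d : I.Din, fn Al.ini ⟨d, .inl (.inr d.2)⟩ = ⟨I.ini d, .inl (.inl (I.ini d).2)⟩
  fn_fin : ∀ d : I.D, fn Al.fin ⟨d, .inl (.inl d.2)⟩ = ⟨I.fin d, .inr (I.fin d).2⟩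
  fn_op : ∀ (o : Al.Op) (d : I.D),
    fn o.1 ⟨d, .inl (.inl d.2)⟩ = ⟨I.op o d, .inl (.inl (I.op o d).2)⟩
  pr_pred : ∀ (p : Al.P) (d : I.D), pr p ⟨d, .inl (.inl d.2)⟩ = I.pred p d

section Evaluation

variable {Al : Alphabet.{u}} {U : Type w} {I : Interp Al U} (𝔇 : DataAlgebra I) {W : Type b}

/-- The value of a term of sort `Data` under an assignment `η` to the flexible variables. -/
def DTerm.eval (η : W → I.Carrier) : DTerm Al I.Din W → I.Carrier
  | .flex x => η x
  | .const c => ⟨c, .inl (.inr c.2)⟩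
  | .app f e => 𝔇.fn f (e.eval η)

def BTerm.eval (η : W → I.Carrier) : BTerm Al I.Din W → Bool
  | .zero => false
  | .one => true
  | .app p e => 𝔇.pr p (e.eval 𝔇 η)

/-- A term of sort `Cond`, taken as a formula with the flexible variables as its variables, is
satisfied in the algebra under the assignment `η`. -/
def CTerm.Sat (η : W → I.Carrier) : CTerm Al I.Din W → Prop
  | .eqB t t' => t.eval 𝔇 η = t'.eval 𝔇 η
  | .eqD e e' => e.eval 𝔇 η = e'.eval 𝔇 η
  | .tt => True
  | .ff => False
  | .not φ => ¬ φ.Sat η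
  | .and φ ψ => φ.Sat η ∧ ψ.Sat η
  | .or φ ψ => φ.Sat η ∨ ψ.Sat η
  | .imp φ ψ => φ.Sat η → ψ.Sat η

/-- The formula `φ` holds in the algebra. -/
def CTerm.Valid (φ : CTerm Al I.Din W) : Prop := ∀ η : W → I.Carrier, φ.Sat 𝔇 η

/-- The element of the carrier of sort `Data` that is denoted by a data value. -/
def DVal.denote (e : DVal Al I.Din) : I.Carrier := DTerm.eval 𝔇 Empty.elim e

end Evaluation

/-! ## Process terms and recursion -/

/-- The countably infinite set of variables of sort `Proc`. -/
abbrev ProcVar := ℕ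

/-- Terms of sort `Proc` with basic actions from `Act` and additional constants from `K`. -/
inductive PTerm (Al : Alphabet.{u}) (C : Type w) (W : Type b) (Act : Type a) (K : Type v) where
  | var (X : ProcVar)
  | act (α : Act)
  | dead
  | eps
  | alt (t t' : PTerm Al C W Act K)
  | seq (t t' : PTerm Al C W Act K)
  | asg (x : W) (e : DTerm Al C W)
  | gc (φ : CTerm Al C W) (t : PTerm Al C W Act K)
  | eval (ρ : FVal Al C W) (t : PTerm Al C W Act K)
  | const (k : K)

/-- Terms of sort `Proc` without recursion constants. -/
abbrev BPATerm (Al : Alphabet.{u}) (C : Type w) (W : Type b) (Act : Type a) :=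
  PTerm Al C W Act Empty

section Terms

variable {Al : Alphabet.{u}} {C : Type w} {W : Type b} {Act : Type a}

/-- The variables that occur in a term. -/
def PTerm.vars {K : Type v} : PTerm Al C W Act K → Set ProcVar
  | .var X => {X}
  | .alt t t' => t.vars ∪ t'.vars
  | .seq t t' => t.vars ∪ t'.vars
  | .gc _ t => t.vars
  | .eval _ t => t.vars
  | _ => ∅

/-- Simultaneous substitution of terms for the variables of a term without recursion constants. -/
def PTerm.subst {K : Type v} (σ : ProcVar → PTerm Al C W Act K) :
    BPATerm Al C W Act → PTerm Al C W Act K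
  | .var X => σ X
  | .act α => .act α
  | .dead => .dead
  | .eps => .eps
  | .alt t t' => .alt (t.subst σ) (t'.subst σ)
  | .seq t t' => .seq (t.subst σ) (t'.subst σ)
  | .asg x e => .asg x e
  | .gc φ t => .gc φ (t.subst σ)
  | .eval ρ t => .eval ρ (t.subst σ)

/-- The terms that denote atomic processes. -/
inductive PTerm.IsAtomic : BPATerm Al C W Act → Prop
  | act (α : Act) : IsAtomic (.act α)
  | asg (x : W) (e : DTerm Al C W) : IsAtomic (.asg x e)

/-- Linear terms. -/
inductive PTerm.IsLinear : BPATerm Al C W Act → Prop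
  | dead : IsLinear .dead
  | eps (φ : CTerm Al C W) : IsLinear (.gc φ .eps)
  | act (φ : CTerm Al C W) (α : BPATerm Al C W Act) (X : ProcVar) : α.IsAtomic →
      IsLinear (.gc φ (.seq α (.var X)))
  | alt (t t' : BPATerm Al C W Act) : IsLinear t → IsLinear t' → t ≠ .dead → t' ≠ .dead →
      IsLinear (.alt t t')

end Terms

/-- Linear recursive specifications: `rhs X = some t` means that `X = t` is one of the equations.
Every variable in a right-hand side has an equation. -/
structure LinSpec (Al : Alphabet.{u}) (C : Type w) (W : Type b) (Act : Type a) where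
  rhs : ProcVar → Option (BPATerm Al C W Act)
  linear : ∀ X t, rhs X = some t → t.IsLinear
  closed : ∀ X t, rhs X = some t → ∀ Y ∈ t.vars, rhs Y ≠ none

section Recursion

variable {Al : Alphabet.{u}} {C : Type w} {W : Type b} {Act : Type a}

def LinSpec.vars (S : LinSpec Al C W Act) : Set ProcVar := {X | S.rhs X ≠ none}

end Recursion

/-- The recursion constants `⟨X|S⟩`. -/
structure RecConst (Al : Alphabet.{u}) (C : Type w) (W : Type b) (Act : Type a) where
  var : ProcVar
  spec : LinSpec Al C W Act
  mem : var ∈ spec.vars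

/-- Terms of sort `Proc` of the process algebra extended with recursion. -/
abbrev RTerm (Al : Alphabet.{u}) (C : Type w) (W : Type b) (Act : Type a) :=
  PTerm Al C W Act (RecConst Al C W Act)

open Classical in
/-- The substitution of `⟨X|S⟩` for each variable `X` of `S`. -/
noncomputable def LinSpec.recSubst {Al : Alphabet.{u}} {C : Type w} {W : Type b} {Act : Type a}
    (S : LinSpec Al C W Act) (X : ProcVar) : RTerm Al C W Act :=
  if h : X ∈ S.vars then .const ⟨X, S, h⟩ else .var X

/-! ## Derivability

Many-sorted (conditional) equational logic. Variables in axioms may be replaced by arbitrary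
terms. -/

section Derivability

variable {Al : Alphabet.{u}} {U : Type w} {I : Interp Al U} (𝔇 : DataAlgebra I) {W : Type b}
  {Act : Type a}

/-- Derivable equations between terms of sort `Data`. -/
inductive DDeriv : DTerm Al I.Din W → DTerm Al I.Din W → Prop
  | refl (e) : DDeriv e e
  | symm {e e'} : DDeriv e e' → DDeriv e' e
  | trans {e e' e''} : DDeriv e e' → DDeriv e' e'' → DDeriv e e''
  | app (f) {e e'} : DDeriv e e' → DDeriv (.app f e) (.app f e')
  | IMP1 (e e') : (CTerm.eqD e e').Valid 𝔇 → DDeriv e e'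

/-- Derivable equations between terms of sort `Bool`. -/
inductive BDeriv : BTerm Al I.Din W → BTerm Al I.Din W → Prop
  | refl (t) : BDeriv t t
  | symm {t t'} : BDeriv t t' → BDeriv t' t
  | trans {t t' t''} : BDeriv t t' → BDeriv t' t'' → BDeriv t t''
  | app (p) {e e'} : DDeriv 𝔇 e e' → BDeriv (.app p e) (.app p e')

/-- Derivable equations between terms of sort `Cond`. -/
inductive CDeriv : CTerm Al I.Din W → CTerm Al I.Din W → Prop
  | refl (φ) : CDeriv φ φ
  | symm {φ φ'} : CDeriv φ φ' → CDeriv φ' φ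
  | trans {φ φ' φ''} : CDeriv φ φ' → CDeriv φ' φ'' → CDeriv φ φ''
  | eqB {t₁ t₁' t₂ t₂'} : BDeriv 𝔇 t₁ t₁' → BDeriv 𝔇 t₂ t₂' → CDeriv (.eqB t₁ t₂) (.eqB t₁' t₂')
  | eqD {e₁ e₁' e₂ e₂'} : DDeriv 𝔇 e₁ e₁' → DDeriv 𝔇 e₂ e₂' → CDeriv (.eqD e₁ e₂) (.eqD e₁' e₂')
  | not {φ φ'} : CDeriv φ φ' → CDeriv (.not φ) (.not φ')
  | and {φ φ' ψ ψ'} : CDeriv φ φ' → CDeriv ψ ψ' → CDeriv (.and φ ψ) (.and φ' ψ')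
  | or {φ φ' ψ ψ'} : CDeriv φ φ' → CDeriv ψ ψ' → CDeriv (.or φ ψ) (.or φ' ψ')
  | imp {φ φ' ψ ψ'} : CDeriv φ φ' → CDeriv ψ ψ' → CDeriv (.imp φ ψ) (.imp φ' ψ')
  | IMP2 (φ ψ) : (CTerm.iff φ ψ).Valid 𝔇 → CDeriv φ ψ

/-- Derivable equations between terms of sort `Proc`. -/
inductive PDeriv : RTerm Al I.Din W Act → RTerm Al I.Din W Act → Prop
  | refl (x) : PDeriv x x
  | symm {x y} : PDeriv x y → PDeriv y x
  | trans {x y z} : PDeriv x y → PDeriv y z → PDeriv x z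
  | alt {x x' y y'} : PDeriv x x' → PDeriv y y' → PDeriv (.alt x y) (.alt x' y')
  | seq {x x' y y'} : PDeriv x x' → PDeriv y y' → PDeriv (.seq x y) (.seq x' y')
  | asg (v) {e e'} : DDeriv 𝔇 e e' → PDeriv (.asg v e) (.asg v e')
  | gc {φ φ' x x'} : CDeriv 𝔇 φ φ' → PDeriv x x' → PDeriv (.gc φ x) (.gc φ' x')
  | eval (ρ) {x x'} : PDeriv x x' → PDeriv (.eval ρ x) (.eval ρ x')
  | A1 (x y) : PDeriv (.alt x y) (.alt y x)
  | A2 (x y z) : PDeriv (.alt (.alt x y) z) (.alt x (.alt y z))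
  | A3 (x) : PDeriv (.alt x x) x
  | A4 (x y z) : PDeriv (.seq (.alt x y) z) (.alt (.seq x z) (.seq y z))
  | A5 (x y z) : PDeriv (.seq (.seq x y) z) (.seq x (.seq y z))
  | A6 (x) : PDeriv (.alt x .dead) x
  | A7 (x) : PDeriv (.seq .dead x) .dead
  | A8 (x) : PDeriv (.seq x .eps) x
  | A9 (x) : PDeriv (.seq .eps x) x
  | GC1 (x) : PDeriv (.gc .tt x) x
  | GC2 (x) : PDeriv (.gc .ff x) .dead
  | GC3 (φ) : PDeriv (.gc φ .dead) .dead
  | GC4 (φ x y) : PDeriv (.gc φ (.alt x y)) (.alt (.gc φ x) (.gc φ y))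
  | GC5 (φ x y) : PDeriv (.gc φ (.seq x y)) (.seq (.gc φ x) y)
  | GC6 (φ ψ x) : PDeriv (.gc φ (.gc ψ x)) (.gc (.and φ ψ) x)
  | GC7 (φ ψ x) : PDeriv (.gc (.or φ ψ) x) (.alt (.gc φ x) (.gc ψ x))
  | V1 (ρ) : PDeriv (.eval ρ .eps) .eps
  | V2 (ρ α x) : PDeriv (.eval ρ (.seq (.act α) x)) (.seq (.act α) (.eval ρ x))
  | V3 (ρ v e x) : PDeriv (.eval ρ (.seq (.asg v e) x))
      (.seq (.asg v ((e.val ρ).lift W)) (.eval (FVal.upd ρ v (e.val ρ)) x))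
  | V4 (ρ x y) : PDeriv (.eval ρ (.alt x y)) (.alt (.eval ρ x) (.eval ρ y))
  | V5 (ρ φ x) : PDeriv (.eval ρ (.gc φ x)) (.gc (φ.val ρ) (.eval ρ x))
  | RDP (c : RecConst Al I.Din W Act) (t) : c.spec.rhs c.var = some t →
      PDeriv (.const c) (t.subst c.spec.recSubst)
  | RSP (c : RecConst Al I.Din W Act) (σ : ProcVar → RTerm Al I.Din W Act) :
      (∀ Y t, c.spec.rhs Y = some t → PDeriv (σ Y) (t.subst σ)) → PDeriv (σ c.var) (.const c)

end Derivability

/-! ## Algorithm processes and the graph-to-process function -/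

section AlgorithmProcesses

variable {Al : Alphabet.{u}} {C : Type w} {W : Type b} {Act : Type a} (mem : W)

/-- The term `T :→ [mem := f(mem)] · Z`. -/
def fnTerm (f : Al.F) (Z : ProcVar) : BPATerm Al C W Act :=
  .gc .tt (.seq (.asg mem (.app f (.flex mem))) (.var Z))

/-- The term `(p(mem) = 1) :→ [mem := mem] · Z + (p(mem) = 0) :→ [mem := mem] · Z'`. -/
def predTerm (p : Al.P) (Z Z' : ProcVar) : BPATerm Al C W Act :=
  .alt (.gc (.eqB (.app p (.flex mem)) .one) (.seq (.asg mem (.flex mem)) (.var Z)))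
    (.gc (.eqB (.app p (.flex mem)) .zero) (.seq (.asg mem (.flex mem)) (.var Z')))

/-- The term `T :→ ε`. -/
def epsTerm : BPATerm Al C W Act := .gc .tt .eps

/-- `c = ⟨X|S⟩` is an algorithm process with `Xε` as the distinguished variable of `S`. -/
structure IsAlgProcess (c : RecConst Al C W Act) (Xε : ProcVar) : Prop where
  finite : c.spec.vars.Finite
  mem_vars : Xε ∈ c.spec.vars
  form : ∀ Y t, c.spec.rhs Y = some t →
    (∃ Z ∈ c.spec.vars \ {Xε}, t = fnTerm mem Al.ini Z) ∨
    (∃ o : Al.Op, ∃ Z ∈ c.spec.vars \ {Xε}, t = fnTerm mem o.1 Z) ∨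
    (∃ p : Al.P, ∃ Z ∈ c.spec.vars \ {Xε}, ∃ Z' ∈ c.spec.vars \ {Xε}, t = predTerm mem p Z Z') ∨
    t = fnTerm mem Al.fin Xε ∨
    t = epsTerm
  ini_iff : ∀ Y t, c.spec.rhs Y = some t →
    ((∃ Z ∈ c.spec.vars \ {Xε}, t = fnTerm mem Al.ini Z) ↔ Y = c.var)
  eps_iff : ∀ Y t, c.spec.rhs Y = some t → (t = epsTerm ↔ Y = Xε)

/-- `c = ⟨X|S⟩` is a value of the graph-to-process function at `G`, for some choice of names:
`x v` is the variable `X_v` of vertex `v` (`X` itself for the root) and `Xε` is the variable of the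
terminating process. -/
def IsGraphProcess (G : AlgGraph.{u, v} Al) (c : RecConst Al C W Act) : Prop :=
  ∃ (x : G.V → ProcVar) (Xε : ProcVar), Function.Injective x ∧ IsAlgProcess mem c Xε ∧
    c.var = x G.root ∧ c.spec.vars = insert Xε (Set.range x) ∧
    (∀ v', c.spec.rhs c.var = some (fnTerm mem Al.ini (x v')) ↔ G.E G.root v') ∧
    (∀ (v v' : G.V) (o : Al.Op), c.spec.rhs (x v) = some (fnTerm mem o.1 (x v')) ↔
      G.vlabel v = some (Sum.inl o.1) ∧ G.E v v') ∧
    (∀ (v v' v'' : G.V) (p : Al.P), c.spec.rhs (x v) = some (predTerm mem p (x v') (x v'')) ↔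
      G.vlabel v = some (Sum.inr p) ∧ G.E v v' ∧ G.E v v'' ∧
        G.elabel v v' = some true ∧ G.elabel v v'' = some false) ∧
    (∀ v : G.V, c.spec.rhs (x v) = some (fnTerm mem Al.fin Xε) ↔
      G.vlabel v = some (Sum.inl Al.fin)) ∧
    c.spec.rhs Xε = some epsTerm

end AlgorithmProcesses

/-! Equality of processes is tested in a model that sees only successfully terminating runs. A term
denotes, for each initial assignment to the flexible variables, a set of finite lists, with one
entry per atomic process: the variable and the value it receives, or `none` for a basic action.
Values are recorded instead of terms, so replacing a data term by an equal one changes nothing.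

All axioms hold in this model (`PDeriv.sound`). The delicate one is RSP: in a linear term every
process variable stands behind one atomic process, so whether a list is a run is decided by strictly
shorter lists, and a linear specification has exactly one solution on its variables
(`LinSpec.sol_unique`).

In the process of a graph, each algorithmic step is one assignment to `mem`, and the last equation
contributes the empty run. Hence the algorithm halts on `d` after `n` steps with output `o` iff its
process, started with `d` in `mem`, has a run of length `n` leaving `o` there
(`IsGraphProcess.haltsIn_iff`). Derivable equality therefore forces equal halting times and outputs.
That suffices for a simulation (`ProtoAlg.algSimulated_of_haltsIn`): run both algorithms in lockstep
from the same input. Divergent inputs are harmless, since internal states may be related freely. -/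

/-! ## Semantics of terminated runs -/

section Runs

variable {Al : Alphabet.{u}} {U : Type w} {I : Interp Al U} (𝔇 : DataAlgebra I) {W : Type b}
  {Act : Type a}

/-- The assignment denoted by a flexible variable valuation. -/
def FVal.denote (ρ : FVal Al I.Din W) (x : W) : I.Carrier := DVal.denote 𝔇 (ρ x)

/-! ### Substitution lemmas: syntactic valuations against semantic assignments. -/

theorem DTerm.denote_val (ρ : FVal Al I.Din W) (e : DTerm Al I.Din W) :
    DVal.denote 𝔇 (e.val ρ) = e.eval 𝔇 (FVal.denote 𝔇 ρ) := by
  induction e with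
  | flex x => rfl
  | const c => rfl
  | app f e ih => exact congrArg (𝔇.fn f) ih

theorem DTerm.eval_lift (η : W → I.Carrier) (e : DVal Al I.Din) :
    (e.lift W).eval 𝔇 η = DVal.denote 𝔇 e := by
  induction e with
  | flex x => exact x.elim
  | const c => rfl
  | app f e ih => exact congrArg (𝔇.fn f) ih

theorem DTerm.eval_lift_val (η : W → I.Carrier) (ρ : FVal Al I.Din W) (e : DTerm Al I.Din W) :
    ((e.val ρ).lift W).eval 𝔇 η = e.eval 𝔇 (FVal.denote 𝔇 ρ) := by
  rw [DTerm.eval_lift, DTerm.denote_val]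

theorem BTerm.eval_val (η : W → I.Carrier) (ρ : FVal Al I.Din W) (t : BTerm Al I.Din W) :
    (t.val ρ).eval 𝔇 η = t.eval 𝔇 (FVal.denote 𝔇 ρ) := by
  cases t with
  | zero => rfl
  | one => rfl
  | app p e => exact congrArg (𝔇.pr p) (DTerm.eval_lift_val 𝔇 η ρ e)

/-- A valuation removes all flexible variables, so the outer assignment `η` becomes irrelevant. This
is what axiom V5 needs. -/
theorem CTerm.sat_val (η : W → I.Carrier) (ρ : FVal Al I.Din W) (φ : CTerm Al I.Din W) :
    (φ.val ρ).Sat 𝔇 η ↔ φ.Sat 𝔇 (FVal.denote 𝔇 ρ) := by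
  induction φ <;> simp_all [CTerm.val, CTerm.Sat, DTerm.eval_lift_val, BTerm.eval_val]

open Classical in
theorem FVal.denote_upd (ρ : FVal Al I.Din W) (x : W) (e : DVal Al I.Din) :
    FVal.denote 𝔇 (ρ.upd x e) = Function.update (FVal.denote 𝔇 ρ) x (DVal.denote 𝔇 e) := by
  funext y
  by_cases h : y = x
  · subst h; simp [FVal.denote, FVal.upd]
  · simp [FVal.denote, FVal.upd, h]

/-! ### Soundness of derivations for data terms and conditions. -/

theorem DDeriv.sound {e e' : DTerm Al I.Din W} (h : DDeriv 𝔇 e e') (η : W → I.Carrier) :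
    e.eval 𝔇 η = e'.eval 𝔇 η := by
  induction h with
  | refl => rfl
  | symm _ ih => exact ih.symm
  | trans _ _ ih ih' => exact ih.trans ih'
  | app f _ ih => exact congrArg (𝔇.fn f) ih
  | IMP1 e e' h => exact h η

theorem BDeriv.sound {t t' : BTerm Al I.Din W} (h : BDeriv 𝔇 t t') (η : W → I.Carrier) :
    t.eval 𝔇 η = t'.eval 𝔇 η := by
  induction h with
  | refl => rfl
  | symm _ ih => exact ih.symm
  | trans _ _ ih ih' => exact ih.trans ih'
  | app p h => exact congrArg (𝔇.pr p) (h.sound 𝔇 η)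

theorem CDeriv.sound {φ φ' : CTerm Al I.Din W} (h : CDeriv 𝔇 φ φ') (η : W → I.Carrier) :
    φ.Sat 𝔇 η ↔ φ'.Sat 𝔇 η := by
  induction h with
  | refl => rfl
  | symm _ ih => exact ih.symm
  | trans _ _ ih ih' => exact ih.trans ih'
  | eqB h h' => simp only [CTerm.Sat, h.sound 𝔇 η, h'.sound 𝔇 η]
  | eqD h h' => simp only [CTerm.Sat, h.sound 𝔇 η, h'.sound 𝔇 η]
  | not _ ih => simp only [CTerm.Sat, ih]
  | and _ _ ih ih' => simp only [CTerm.Sat, ih, ih']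
  | or _ _ ih ih' => simp only [CTerm.Sat, ih, ih']
  | imp _ _ ih ih' => simp only [CTerm.Sat, ih, ih']
  | IMP2 φ ψ h => exact ⟨(h η).1, (h η).2⟩

/-- A run records for each atomic process the update it performs, `none` for a basic action. -/
abbrev Run (I : Interp Al U) (W : Type b) := List (Option (W × I.Carrier))

/-- The assignment that results from a run. -/
noncomputable def Run.after : (W → I.Carrier) → Run I W → W → I.Carrier
  | η, [] => η
  | η, none :: w => Run.after η w
  | η, some (x, u) :: w => Run.after (open Classical in Function.update η x u) w

theorem Run.after_append (η : W → I.Carrier) (w w' : Run I W) :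
    Run.after η (w ++ w') = Run.after (Run.after η w) w' := by
  induction w generalizing η with
  | nil => rfl
  | cons o w ih => rcases o with _ | ⟨x, u⟩ <;> exact ih _

/-- Sets of runs, dependent on the initial assignment. -/
abbrev RunSet (I : Interp Al U) (W : Type b) := (W → I.Carrier) → Run I W → Prop

/-- The successfully terminating runs of a term. -/
def PTerm.Runs {K : Type v} (κ : K → RunSet I W) (τ : ProcVar → RunSet I W) :
    PTerm Al I.Din W Act K → RunSet I W
  | .var X, η, w => τ X η w
  | .act _, _, w => w = [none]
  | .dead, _, _ => False
  | .eps, _, w => w = []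
  | .alt t t', η, w => t.Runs κ τ η w ∨ t'.Runs κ τ η w
  | .seq t t', η, w => ∃ w₁ w₂, w = w₁ ++ w₂ ∧ t.Runs κ τ η w₁ ∧ t'.Runs κ τ (Run.after η w₁) w₂
  | .asg x e, η, w => w = [some (x, e.eval 𝔇 η)]
  | .gc φ t, η, w => φ.Sat 𝔇 η ∧ t.Runs κ τ η w
  -- Evaluation discards the current assignment and starts from the one denoted by `ρ`.
  | .eval ρ t, _, w => t.Runs κ τ (FVal.denote 𝔇 ρ) w
  | .const k, η, w => κ k η w

/-- The runs of a term without recursion constants. -/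
abbrev PTerm.BRuns (τ : ProcVar → RunSet I W) (t : BPATerm Al I.Din W Act) : RunSet I W :=
  t.Runs 𝔇 (fun k => k.elim) τ

theorem PTerm.runs_subst {K : Type v} (κ : K → RunSet I W) (τ : ProcVar → RunSet I W)
    (σ : ProcVar → PTerm Al I.Din W Act K) (t : BPATerm Al I.Din W Act) :
    (t.subst σ).Runs 𝔇 κ τ = t.BRuns 𝔇 (fun X => (σ X).Runs 𝔇 κ τ) := by
  induction t with
  | const k => exact k.elim
  | _ => simp_all [PTerm.subst, PTerm.Runs, funext_iff]

theorem PTerm.IsAtomic.length_eq_one {t : BPATerm Al I.Din W Act} (h : t.IsAtomic)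
    {τ : ProcVar → RunSet I W} {η : W → I.Carrier} {w : Run I W} (hw : t.BRuns 𝔇 τ η w) :
    w.length = 1 := by
  cases h <;> simp only [PTerm.BRuns, PTerm.Runs] at hw <;> subst hw <;> rfl

theorem PTerm.IsAtomic.runs_congr {t : BPATerm Al I.Din W Act} (h : t.IsAtomic)
    (τ τ' : ProcVar → RunSet I W) : t.BRuns 𝔇 τ = t.BRuns 𝔇 τ' := by
  cases h <;> rfl

/-- The runs of a linear term are determined by shorter runs of its variables. -/
theorem PTerm.IsLinear.runs_congr {t : BPATerm Al I.Din W Act} (h : t.IsLinear)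
    {τ τ' : ProcVar → RunSet I W} {w : Run I W}
    (hτ : ∀ X ∈ t.vars, ∀ η (w' : Run I W), w'.length < w.length → (τ X η w' ↔ τ' X η w'))
    (η : W → I.Carrier) : t.BRuns 𝔇 τ η w ↔ t.BRuns 𝔇 τ' η w := by
  induction h with
  | dead => rfl
  | eps φ => rfl
  | act φ α X hα =>
    refine and_congr_right fun _ => exists_congr fun w₁ => exists_congr fun w₂ =>
      and_congr_right fun hw => ?_
    change α.BRuns 𝔇 τ η w₁ ∧ _ ↔ α.BRuns 𝔇 τ' η w₁ ∧ _
    rw [hα.runs_congr 𝔇 τ τ']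
    -- The atomic prefix uses up one entry, so the variable is only asked about a strictly shorter
    -- run.
    refine and_congr_right fun hw₁ => hτ X (by simp [PTerm.vars]) _ _ ?_
    have := hα.length_eq_one 𝔇 hw₁
    simp [hw, this]
  | alt t t' _ _ _ _ ih ih' =>
    exact or_congr (ih fun X hX => hτ X (.inl hX)) (ih' fun X hX => hτ X (.inr hX))

/-! ### Existence and uniqueness of solutions of linear specifications. -/

namespace LinSpec

variable (S : LinSpec Al I.Din W Act)

/-- The runs obtained by unfolding the equations at most `n` times. -/
def approx : ℕ → ProcVar → RunSet I W
  | 0, _, _, _ => False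
  | n + 1, X, η, w => ∃ t, S.rhs X = some t ∧ t.BRuns 𝔇 (approx n) η w

/-- The solution of a linear specification. -/
def sol (X : ProcVar) : RunSet I W := fun η w => S.approx 𝔇 (w.length + 1) X η w

/-- Each unfolding that passes to another variable consumes one entry of `w`, and one more unfolding
must produce `ε`. Any number above `w.length` is thus enough, whence the `+ 1` in `sol`. -/
theorem approx_eq (n m : ℕ) (X : ProcVar) (η : W → I.Carrier) (w : Run I W)
    (hn : w.length < n) (hm : w.length < m) : S.approx 𝔇 n X η w ↔ S.approx 𝔇 m X η w := by
  induction n generalizing m X η w with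
  | zero => omega
  | succ n ih =>
    obtain ⟨m, rfl⟩ : ∃ k, m = k + 1 := ⟨m - 1, by omega⟩
    refine exists_congr fun t => and_congr_right fun ht => (S.linear X t ht).runs_congr 𝔇 ?_ η
    intro Y _ η' w' hw'
    exact ih m Y η' w' (by omega) (by omega)

theorem sol_iff (X : ProcVar) (η : W → I.Carrier) (w : Run I W) :
    S.sol 𝔇 X η w ↔ ∃ t, S.rhs X = some t ∧ t.BRuns 𝔇 (S.sol 𝔇) η w := by
  refine exists_congr fun t => and_congr_right fun ht => (S.linear X t ht).runs_congr 𝔇 ?_ η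
  intro Y _ η' w' hw'
  exact S.approx_eq 𝔇 _ _ Y η' w' hw' (by omega)

theorem sol_iff_of_rhs {X : ProcVar} {t : BPATerm Al I.Din W Act} (ht : S.rhs X = some t)
    (η : W → I.Carrier) (w : Run I W) : S.sol 𝔇 X η w ↔ t.BRuns 𝔇 (S.sol 𝔇) η w := by
  rw [sol_iff, ht]; simp

/-- The semantic form of RSP, by strong induction on the length of the run. `S.closed` keeps the
induction inside the variables of `S`, outside which `τ` is arbitrary. -/
theorem sol_unique (τ : ProcVar → RunSet I W)
    (hτ : ∀ X t, S.rhs X = some t → τ X = t.BRuns 𝔇 τ) (X : ProcVar) (hX : X ∈ S.vars) :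
    τ X = S.sol 𝔇 X := by
  suffices h : ∀ (n : ℕ) (w : Run I W), w.length = n → ∀ X ∈ S.vars, ∀ η,
      (τ X η w ↔ S.sol 𝔇 X η w) by
    funext η w
    exact propext (h _ w rfl X hX η)
  intro n
  induction n using Nat.strong_induction_on with
  | _ n ih =>
    intro w hw X hX η
    obtain ⟨t, ht⟩ := Option.ne_none_iff_exists'.1 hX
    rw [S.sol_iff_of_rhs 𝔇 ht, hτ X t ht]
    refine (S.linear X t ht).runs_congr 𝔇 ?_ η
    intro Y hY η' w' hw'
    exact ih _ (hw ▸ hw') w' rfl Y (S.closed X t ht Y hY) η'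

end LinSpec

/-! ### Soundness of the process axioms. -/

/-- The runs of a term of the process algebra with recursion; free variables have no runs. -/
abbrev PTerm.RRuns (t : RTerm Al I.Din W Act) : RunSet I W :=
  t.Runs 𝔇 (fun c => c.spec.sol 𝔇 c.var) (fun _ _ _ => False)

/-- Outside the variables of `S` both sides are empty: free variables have no runs, and `sol` finds
no equation to unfold. -/
theorem LinSpec.runs_recSubst (S : LinSpec Al I.Din W Act) (X : ProcVar) :
    (S.recSubst X).RRuns 𝔇 = S.sol 𝔇 X := by
  by_cases h : X ∈ S.vars
  · rw [LinSpec.recSubst, dif_pos h]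
    rfl
  · funext η w
    have hX : S.rhs X = none := not_not.1 h
    simp [LinSpec.recSubst, h, PTerm.Runs, S.sol_iff, hX]

theorem PDeriv.sound {x y : RTerm Al I.Din W Act} (h : PDeriv 𝔇 x y) :
    x.RRuns 𝔇 = y.RRuns 𝔇 := by
  induction h with
  | refl => rfl
  | symm _ ih => exact ih.symm
  | trans _ _ ih ih' => exact ih.trans ih'
  | alt _ _ ih ih' => funext η w; simp only [PTerm.Runs, ih, ih']
  | seq _ _ ih ih' => funext η w; simp only [PTerm.Runs, ih, ih']
  | asg v h => funext η w; simp only [PTerm.Runs, h.sound 𝔇 η]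
  | gc h _ ih => funext η w; simp only [PTerm.Runs, ih, h.sound 𝔇 η]
  | eval ρ _ ih => funext η w; simp only [PTerm.Runs, ih]
  | A1 => funext η w; simp only [PTerm.Runs, or_comm]
  | A2 => funext η w; simp only [PTerm.Runs, or_assoc]
  | A3 => funext η w; simp only [PTerm.Runs, or_self]
  | A4 x y z =>
    funext η w
    simp only [PTerm.Runs, or_and_right, and_or_left, exists_or]
  | A5 x y z =>
    funext η w
    simp only [PTerm.Runs, eq_iff_iff]
    constructor
    · rintro ⟨_, w₃, rfl, ⟨w₁, w₂, rfl, h₁, h₂⟩, h₃⟩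
      rw [Run.after_append] at h₃
      exact ⟨w₁, w₂ ++ w₃, by simp, h₁, w₂, w₃, rfl, h₂, h₃⟩
    · rintro ⟨w₁, _, rfl, h₁, w₂, w₃, rfl, h₂, h₃⟩
      refine ⟨w₁ ++ w₂, w₃, by simp, ⟨w₁, w₂, rfl, h₁, h₂⟩, ?_⟩
      rwa [Run.after_append]
  | A6 => funext η w; simp only [PTerm.Runs, or_false]
  | A7 => funext η w; simp [PTerm.Runs]
  | A8 => funext η w; simp [PTerm.Runs]
  | A9 => funext η w; simp [PTerm.Runs, Run.after]
  | GC1 => funext η w; simp [PTerm.Runs, CTerm.Sat]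
  | GC2 => funext η w; simp [PTerm.Runs, CTerm.Sat]
  | GC3 => funext η w; simp [PTerm.Runs]
  | GC4 => funext η w; simp [PTerm.Runs, and_or_left]
  | GC5 =>
    funext η w
    simp only [PTerm.Runs, eq_iff_iff]
    constructor
    · rintro ⟨h, w₁, w₂, hw, h₁, h₂⟩
      exact ⟨w₁, w₂, hw, ⟨h, h₁⟩, h₂⟩
    · rintro ⟨w₁, w₂, hw, ⟨h, h₁⟩, h₂⟩
      exact ⟨h, w₁, w₂, hw, h₁, h₂⟩
  | GC6 => funext η w; simp [PTerm.Runs, CTerm.Sat, and_assoc]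
  | GC7 => funext η w; simp [PTerm.Runs, CTerm.Sat, or_and_right]
  | V1 => funext η w; simp [PTerm.Runs]
  | V2 => funext η w; simp [PTerm.Runs, Run.after]
  | V3 =>
    funext η w
    -- Both sides record the same value, and updating `ρ` syntactically agrees with the effect of
    -- that entry on the assignment.
    simp [PTerm.Runs, Run.after, DTerm.eval_lift_val, FVal.denote_upd, DTerm.denote_val]
  | V4 => funext η w; simp [PTerm.Runs]
  | V5 => funext η w; simp [PTerm.Runs, CTerm.sat_val]
  | RDP c t ht =>
    rw [PTerm.RRuns, PTerm.RRuns, PTerm.runs_subst]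
    simp only [LinSpec.runs_recSubst]
    funext η w
    exact propext (c.spec.sol_iff_of_rhs 𝔇 ht η w)
  | RSP c σ _ ih =>
    -- The runs of the terms `σ X` satisfy the equations of the specification, so uniqueness
    -- identifies them with `sol`.
    refine c.spec.sol_unique 𝔇 (fun X => (σ X).RRuns 𝔇) ?_ c.var c.mem
    intro X t ht
    exact (ih X t ht).trans (PTerm.runs_subst 𝔇 _ _ σ t)

end Runs

/-! ## Terminating runs of proto-algorithms -/

namespace ProtoAlg

section Halting

variable {U : Type w} {A : ProtoAlg.{u, v, w} U}

/-- From state `s` the output `o` is reached after exactly `n` steps. -/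
inductive HaltsIn (A : ProtoAlg.{u, v, w} U) : A.State → ℕ → A.I.Dout → Prop
  | out (o : A.I.Dout) : HaltsIn A (.out o) 0 o
  | step {s t : A.State} {n : ℕ} {o : A.I.Dout} :
      -- Output states step to themselves; excluding them makes `n` the exact halting time.
      (∀ o', s ≠ .out o') → Step A s t → HaltsIn A t n o → HaltsIn A s (n + 1) o

theorem HaltsIn.iterate {s : A.State} {n : ℕ} {o : A.I.Dout} (h : HaltsIn A s n o) :
    A.astep^[n] s = .out o := by
  induction h with
  | out o => rfl
  | step _ hst _ ih => rw [Function.iterate_succ_apply, astep_eq hst, ih]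

theorem iterate_out (n : ℕ) (o : A.I.Dout) : A.astep^[n] (.out o) = .out o :=
  Function.iterate_fixed (astep_eq (.out o)) n

theorem not_edge_root {x : A.G.V} : ¬ A.G.E x A.G.root := by
  intro h
  have := A.G.finite_V
  have h0 := (A.G.ini_deg _ ((A.G.ini_iff A.G.root).2 rfl)).1
  rw [LGraph.indeg, Set.ncard_eq_zero] at h0
  exact (Set.ext_iff.1 h0 x).1 h

/-- The stuck states at the root are never entered, because the root has indegree `0`. Inductions
along a computation can thus carry the hypothesis that makes `Step.exists` applicable. -/
theorem Step.ne_root {s t : A.State} (h : Step A s t) (d : A.I.D) : t ≠ .int A.G.root d := by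
  rintro rfl
  cases h with
  | inp d y hE => exact not_edge_root hE
  | op x y d o hl hE => exact not_edge_root hE
  | pred x y d p hl hE hb => exact not_edge_root hE

/-- Outputs are fixed points of `astep`, so the iterate may have run past the halting time; hence `m
≤ n`. -/
theorem exists_haltsIn_of_iterate {n : ℕ} {s : A.State} (hs : ∀ d, s ≠ .int A.G.root d)
    {o : A.I.Dout} (h : A.astep^[n] s = .out o) : ∃ m ≤ n, HaltsIn A s m o := by
  induction n generalizing s with
  | zero => exact ⟨0, le_rfl, by rw [show s = .out o from h]; exact .out o⟩
  | succ n ih =>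
    by_cases ho : ∃ o', s = .out o'
    · obtain ⟨o', rfl⟩ := ho
      rw [iterate_out] at h
      exact ⟨0, Nat.zero_le _, by rw [h]; exact .out o⟩
    · push Not at ho
      obtain ⟨t, ht⟩ := Step.exists s hs
      rw [Function.iterate_succ_apply, astep_eq ht] at h
      obtain ⟨m, hm, hh⟩ := ih ht.ne_root h
      exact ⟨m + 1, by omega, .step ho ht hh⟩

/-! ### From equal halting behaviour to simulation. -/

theorem astep_ne_inp (s : A.State) (d : A.I.Din) : A.astep s ≠ .inp d := by
  by_cases h : ∃ d', s = .int A.G.root d'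
  · obtain ⟨d', rfl⟩ := h
    have hno : ¬ ∃ t, Step A (.int A.G.root d') t := by
      have hl := (A.G.ini_iff A.G.root).2 rfl
      rintro ⟨t, ht⟩
      cases ht with
      | op _ y _ o ho => exact o.2.1 (by simpa [hl] using ho.symm)
      | pred _ _ _ p hp => simp [hl] at hp
      | fin _ _ hf => exact A.Al.ini_ne_fin (by simpa [hl] using hf)
    rw [astep, dif_neg hno]
    simp
  · push Not at h
    obtain ⟨t, ht⟩ := Step.exists s h
    rw [astep_eq ht]
    cases ht <;> simp

theorem exists_int_or_out_of_iterate_succ (n : ℕ) (s : A.State) :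
    (∃ x d, A.astep^[n + 1] s = .int x d) ∨ ∃ o, A.astep^[n + 1] s = .out o := by
  rw [Function.iterate_succ_apply']
  rcases h : A.astep (A.astep^[n] s) with d | ⟨x, d⟩ | o
  · exact absurd h (astep_ne_inp _ _)
  · exact .inl ⟨x, d, rfl⟩
  · exact .inr ⟨o, rfl⟩

end Halting

/-- Over the same interpretation, an algorithm is simulated by one that halts on the same inputs
after the same number of steps with the same outputs. -/
theorem algSimulated_of_haltsIn {U : Type w} {Al : Alphabet.{u}} {I : Interp Al U}
    {G : AlgGraph.{u, v} Al} {G' : AlgGraph.{u, v'} Al}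
    (h : ∀ (d : I.Din) (n : ℕ) (o : I.Dout),
      HaltsIn ⟨Al, G, I⟩ (.inp d) n o ↔ HaltsIn ⟨Al, G', I⟩ (.inp d) n o) :
    AlgSimulated ⟨Al, G, I⟩ ⟨Al, G', I⟩ := by
  let A : ProtoAlg.{u, v, w} U := ⟨Al, G, I⟩
  let A' : ProtoAlg.{u, v', w} U := ⟨Al, G', I⟩
  have key : ∀ (d : I.Din) (n : ℕ) (o : I.Dout),
      A.astep^[n] (.inp d) = .out o ↔ A'.astep^[n] (.inp d) = .out o := by
    intro d n o
    constructor
    · intro hn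
      obtain ⟨m, hm, hh⟩ := exists_haltsIn_of_iterate (A := A) (by simp) hn
      obtain ⟨k, rfl⟩ := Nat.exists_eq_add_of_le' hm
      -- The `k` surplus iterations take place at the output, which is fixed.
      rw [Function.iterate_add_apply, ((h d m o).1 hh).iterate, iterate_out]
    · intro hn
      obtain ⟨m, hm, hh⟩ := exists_haltsIn_of_iterate (A := A') (by simp) hn
      obtain ⟨k, rfl⟩ := Nat.exists_eq_add_of_le' hm
      rw [Function.iterate_add_apply, ((h d m o).2 hh).iterate, iterate_out]
  -- Lockstep pairs from a common input, together with the diagonal on outputs. The diagonal is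
  -- needed because every member of `Dout`, reached or not, must have a partner.
  refine ⟨fun s s' => (∃ (d : I.Din) (n : ℕ), s = A.astep^[n] (.inp d) ∧
    s' = A'.astep^[n] (.inp d)) ∨ ∃ o : I.Dout, s = .out o ∧ s' = .out o, ?_, ?_, ?_, ?_⟩
  · rintro s s' (⟨d, n, rfl, rfl⟩ | ⟨o, rfl, rfl⟩)
    · rcases n with _ | n
      · exact trivial
      · rcases exists_int_or_out_of_iterate_succ (A := A) n (.inp d) with ⟨x, e, he⟩ | ⟨o, ho⟩
        · rcases exists_int_or_out_of_iterate_succ (A := A') n (.inp d) with ⟨x', e', he'⟩ | ⟨o, ho⟩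
          · rw [he, he']; exact trivial
          -- By `key`, outputs appear at the same time on both sides, so an internal state never
          -- meets an output.
          · rw [(key _ _ _).2 ho] at he; cases he
        · rw [ho, (key _ _ _).1 ho]; exact trivial
    · exact trivial
  · intro d
    refine ⟨d, .inl ⟨d, 0, rfl, rfl⟩, ?_⟩
    rintro d' (⟨e, n, he, he'⟩ | ⟨o, ho, _⟩)
    · rcases n with _ | n
      · cases he; cases he'; rfl
      · rw [Function.iterate_succ_apply'] at he
        exact absurd he.symm (astep_ne_inp _ _)
    · cases ho
  · intro o
    refine ⟨o, .inr ⟨o, rfl, rfl⟩, ?_⟩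
    rintro o' (⟨d, n, hd, hd'⟩ | ⟨e, he, he'⟩)
    -- Here `key` also compares the values: two outputs met in lockstep are equal.
    · have := hd.trans ((key _ _ _).2 hd'.symm)
      cases this; rfl
    · cases he; cases he'; rfl
  · rintro s s' (⟨d, n, rfl, rfl⟩ | ⟨o, rfl, rfl⟩)
    · exact .inl ⟨d, n + 1, (Function.iterate_succ_apply' _ _ _).symm,
        (Function.iterate_succ_apply' _ _ _).symm⟩
    · exact .inr ⟨o, astep_eq (Step.out (A := A) o), astep_eq (Step.out (A := A') o)⟩

end ProtoAlg

/-! ## Runs of graph processes -/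

section GraphProcess

open ProtoAlg

variable {Al : Alphabet.{u}} {U : Type w} {I : Interp Al U} (𝔇 : DataAlgebra I) {W : Type b}
  {Act : Type a}

/-- The element of the carrier held in a state. -/
def ProtoAlg.State.data {G : AlgGraph.{u, v} Al} :
    (State (⟨Al, G, I⟩ : ProtoAlg.{u, v, w} U)) → I.Carrier
  | .inp d => ⟨d, .inl (.inr d.2)⟩
  | .int _ d => ⟨d, .inl (.inl d.2)⟩
  | .out d => ⟨d, .inr d.2⟩

/-- The process variable that corresponds to a state. -/
def ProtoAlg.State.procVar {G : AlgGraph.{u, v} Al} (x : G.V → ProcVar) (Xε : ProcVar) :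
    (State (⟨Al, G, I⟩ : ProtoAlg.{u, v, w} U)) → ProcVar
  | .inp _ => x G.root
  | .int y _ => x y
  | .out _ => Xε

theorem runs_asg_seq {τ : ProcVar → RunSet I W} {m : W} {e : DTerm Al I.Din W} {Z : ProcVar}
    {η : W → I.Carrier} {r : Run I W} :
    (.seq (.asg m e) (.var Z) : BPATerm Al I.Din W Act).BRuns 𝔇 τ η r ↔
      ∃ r', r = some (m, e.eval 𝔇 η) :: r' ∧
        τ Z (Run.after η [some (m, e.eval 𝔇 η)]) r' := by
  constructor
  · rintro ⟨_, r', rfl, rfl, h⟩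
    exact ⟨r', rfl, h⟩
  · rintro ⟨r', rfl, h⟩
    exact ⟨_, r', rfl, rfl, h⟩

theorem runs_fnTerm {τ : ProcVar → RunSet I W} {m : W} {f : Al.F} {Z : ProcVar}
    {η : W → I.Carrier} {r : Run I W} :
    (fnTerm m f Z : BPATerm Al I.Din W Act).BRuns 𝔇 τ η r ↔
      ∃ r', r = some (m, 𝔇.fn f (η m)) :: r' ∧
        τ Z (Run.after η [some (m, 𝔇.fn f (η m))]) r' :=
  Iff.trans (iff_of_eq (true_and _)) (runs_asg_seq 𝔇)

theorem runs_predTerm {τ : ProcVar → RunSet I W} {m : W} {p : Al.P} {Z Z' : ProcVar}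
    {η : W → I.Carrier} {r : Run I W} :
    (predTerm m p Z Z' : BPATerm Al I.Din W Act).BRuns 𝔇 τ η r ↔
      ∃ r', r = some (m, η m) :: r' ∧
        τ (if 𝔇.pr p (η m) then Z else Z') (Run.after η [some (m, η m)]) r' := by
  have h : (predTerm m p Z Z' : BPATerm Al I.Din W Act).BRuns 𝔇 τ η r ↔
      (𝔇.pr p (η m) = true ∧
        (.seq (.asg m (.flex m)) (.var Z) : BPATerm Al I.Din W Act).BRuns 𝔇 τ η r) ∨
      (𝔇.pr p (η m) = false ∧
        (.seq (.asg m (.flex m)) (.var Z') : BPATerm Al I.Din W Act).BRuns 𝔇 τ η r) := Iff.rfl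
  rw [h, runs_asg_seq, runs_asg_seq]
  -- The two guards are complementary, so exactly one summand contributes.
  cases 𝔇.pr p (η m) <;> simp [DTerm.eval]

variable {G : AlgGraph.{u, v} Al} {mem : W} {c : RecConst Al I.Din W Act}

/-- A step of the algorithm is the first step of all runs of the corresponding process. -/
theorem sol_iff_of_step {x : G.V → ProcVar} {Xε : ProcVar} (hr : c.var = x G.root)
    (hini : ∀ v', c.spec.rhs c.var = some (fnTerm mem Al.ini (x v')) ↔ G.E G.root v')
    (hop : ∀ (v v' : G.V) (o : Al.Op), c.spec.rhs (x v) = some (fnTerm mem o.1 (x v')) ↔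
      G.vlabel v = some (Sum.inl o.1) ∧ G.E v v')
    (hpred : ∀ (v v' v'' : G.V) (p : Al.P),
      c.spec.rhs (x v) = some (predTerm mem p (x v') (x v'')) ↔
      G.vlabel v = some (Sum.inr p) ∧ G.E v v' ∧ G.E v v'' ∧
        G.elabel v v' = some true ∧ G.elabel v v'' = some false)
    (hfin : ∀ v : G.V, c.spec.rhs (x v) = some (fnTerm mem Al.fin Xε) ↔
      G.vlabel v = some (Sum.inl Al.fin))
    {s t : State (⟨Al, G, I⟩ : ProtoAlg.{u, v, w} U)} (hs : ∀ o, s ≠ .out o) (hst : Step _ s t)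
    {η : W → I.Carrier} (hη : η mem = s.data) (r : Run I W) :
    c.spec.sol 𝔇 (s.procVar x Xε) η r ↔ ∃ r', r = some (mem, t.data) :: r' ∧
      c.spec.sol 𝔇 (t.procVar x Xε) (Run.after η [some (mem, t.data)]) r' := by
  cases hst with
  | inp d y hE =>
    have hrhs := (hini y).2 hE
    rw [hr] at hrhs
    change c.spec.sol 𝔇 (x G.root) η r ↔ _
    rw [c.spec.sol_iff_of_rhs 𝔇 hrhs, runs_fnTerm, hη]
    simp only [State.data, 𝔇.fn_ini]
    rfl
  | op y z d o hl hE =>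
    change c.spec.sol 𝔇 (x y) η r ↔ _
    rw [c.spec.sol_iff_of_rhs 𝔇 ((hop y z o).2 ⟨hl, hE⟩), runs_fnTerm, hη]
    simp only [State.data, 𝔇.fn_op]
    rfl
  | pred y z d p hl hE hb =>
    change c.spec.sol 𝔇 (x y) η r ↔ _
    obtain ⟨-, h2, h3⟩ := G.pred_deg y p hl
    obtain ⟨z₁, z₂, hz, hz₁, hz₂⟩ : ∃ z₁ z₂, z₁ ≠ z₂ ∧ G.E y z₁ ∧ G.E y z₂ := by
      obtain ⟨z₁, z₂, hz, he⟩ := Set.ncard_eq_two.1 h2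
      exact ⟨z₁, z₂, hz, (Set.ext_iff.1 he z₁).2 (by simp), (Set.ext_iff.1 he z₂).2 (by simp)⟩
    -- The equation of a predicate vertex mentions both successors, so the one not taken has to be
    -- found too.
    obtain ⟨z', hz', hE'⟩ : ∃ z', z ≠ z' ∧ G.E y z' := by
      by_cases h : z = z₁
      · exact ⟨z₂, h ▸ hz, hz₂⟩
      · exact ⟨z₁, h, hz₁⟩
    obtain ⟨-, h5, h6⟩ := h3 z z' hz' hE hE'
    obtain ⟨b', hb'⟩ := Option.ne_none_iff_exists'.1 h5
    have hp : 𝔇.pr p (η mem) = I.pred p d := by rw [hη]; exact 𝔇.pr_pred p d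
    change G.elabel y z = some (I.pred p d) at hb
    rw [hb, hb'] at h6
    rcases hd : I.pred p d with _ | _
    -- The two edge labels differ, so the other edge carries the complementary bit.
    · have : b' = true := by cases b' <;> simp_all
      rw [c.spec.sol_iff_of_rhs 𝔇 ((hpred y z' z p).2 ⟨hl, hE', hE, this ▸ hb', hd ▸ hb⟩),
        runs_predTerm, hp, hd, hη]
      rfl
    · have : b' = false := by cases b' <;> simp_all
      rw [c.spec.sol_iff_of_rhs 𝔇 ((hpred y z z' p).2 ⟨hl, hE, hE', hd ▸ hb, this ▸ hb'⟩),
        runs_predTerm, hp, hd, hη]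
      rfl
  | fin y d hl =>
    change c.spec.sol 𝔇 (x y) η r ↔ _
    rw [c.spec.sol_iff_of_rhs 𝔇 ((hfin y).2 hl), runs_fnTerm, hη]
    simp only [State.data, 𝔇.fn_fin]
    rfl
  | out d => exact absurd rfl (hs d)

theorem Run.after_single_self (η : W → I.Carrier) (m : W) (u : I.Carrier) :
    Run.after η [some (m, u)] m = u := by
  simp [Run.after]

/-- The algorithm halts in `n` steps with output `o` iff its process has a run of length `n` that
leaves `o` in the memory. -/
theorem IsGraphProcess.haltsIn_iff (hc : IsGraphProcess mem G c) (d : I.Din)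
    {η : W → I.Carrier} (hη : (η mem : U) = d) (n : ℕ) (o : I.Dout) :
    HaltsIn (⟨Al, G, I⟩ : ProtoAlg.{u, v, w} U) (.inp d) n o ↔
      ∃ r, c.spec.sol 𝔇 c.var η r ∧ r.length = n ∧ (Run.after η r mem : U) = o := by
  obtain ⟨x, Xε, -, -, hr, -, hini, hop, hpred, hfin, heps⟩ := hc
  have hstep := fun {s t : State (⟨Al, G, I⟩ : ProtoAlg.{u, v, w} U)} hs hst {η} hη r =>
    sol_iff_of_step 𝔇 hr hini hop hpred hfin (s := s) (t := t) hs hst (η := η) hη r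
  have hout : ∀ (η : W → I.Carrier) (r : Run I W), c.spec.sol 𝔇 Xε η r ↔ r = [] := by
    intro η r
    rw [c.spec.sol_iff_of_rhs 𝔇 heps]
    exact iff_of_eq (true_and _)
  have hfwd : ∀ (s : State (⟨Al, G, I⟩ : ProtoAlg.{u, v, w} U)) (n : ℕ), HaltsIn _ s n o →
      ∀ η : W → I.Carrier, η mem = s.data →
      ∃ r, c.spec.sol 𝔇 (s.procVar x Xε) η r ∧ r.length = n ∧ (Run.after η r mem : U) = o := by
    intro s n h
    induction h with
    | out o => exact fun η hη => ⟨[], (hout η []).2 rfl, rfl, congrArg Subtype.val hη⟩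
    | @step s t n o hs hst _ ih =>
      intro η hη
      obtain ⟨r, h₁, h₂, h₃⟩ := ih (Run.after η [some (mem, t.data)])
        (Run.after_single_self η mem t.data)
      exact ⟨_, (hstep hs hst hη _).2 ⟨r, rfl, h₁⟩, by simp [h₂], h₃⟩
  -- States `(r, e)` must be excluded: they share the process variable of the input states but have
  -- no step.
  have hbwd : ∀ (r : Run I W) (s : State (⟨Al, G, I⟩ : ProtoAlg.{u, v, w} U))
      (η : W → I.Carrier), (∀ e, s ≠ .int G.root e) → η mem = s.data →
      c.spec.sol 𝔇 (s.procVar x Xε) η r → (Run.after η r mem : U) = o →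
      HaltsIn _ s r.length o := by
    intro r
    induction r with
    | nil =>
      intro s η hs hη h ho
      by_cases hs' : ∃ o', s = .out o'
      · obtain ⟨o', rfl⟩ := hs'
        have : o' = o := Subtype.ext ((congrArg Subtype.val hη).symm.trans ho)
        subst this
        exact .out _
      -- Before the output, a further step would put an entry into the run, which is empty here.
      · push Not at hs'
        obtain ⟨t, ht⟩ := Step.exists s hs
        obtain ⟨r', hr', -⟩ := (hstep hs' ht hη _).1 h
        cases hr'
    | cons a r ih =>
      intro s η hs hη h ho
      by_cases hs' : ∃ o', s = .out o'
      · obtain ⟨o', rfl⟩ := hs'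
        cases (hout η _).1 h
      · push Not at hs'
        obtain ⟨t, ht⟩ := Step.exists s hs
        obtain ⟨r', hr', h'⟩ := (hstep hs' ht hη _).1 h
        cases hr'
        exact .step hs' ht (ih t _ ht.ne_root (Run.after_single_self η mem t.data) h' ho)
  have hη' : η mem = State.data (G := G) (.inp d) := Subtype.ext hη
  rw [hr]
  constructor
  · exact fun h => hfwd (.inp d) n h η hη'
  · rintro ⟨r, h, rfl, ho⟩
    exact hbwd r (.inp d) η (by simp) hη' h ho

end GraphProcess

theorem theorem3 {U : Type w} (Al : Alphabet.{u}) (I : Interp Al U)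
    (G : AlgGraph.{u, v} Al) (G' : AlgGraph.{u, v'} Al)
    (𝔇 : DataAlgebra I)
    (W : Type b) [Countable W] (mem : W) (Act : Type a) [Finite Act]
    (ρ : I.Din → FVal Al I.Din W)
    (hρ : ∀ d : I.Din, (DVal.denote 𝔇 (ρ d mem) : U) = d)
    (c c' : RecConst Al I.Din W Act)
    (hc : IsGraphProcess mem G c) (hc' : IsGraphProcess mem G' c')
    (h : ∀ d : I.Din, PDeriv 𝔇 (.eval (ρ d) (.const c)) (.eval (ρ d) (.const c'))) :
    ProtoAlg.AlgEquivalent ⟨Al, G, I⟩ ⟨Al, G', I⟩ := by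
  have key : ∀ (d : I.Din) (n : ℕ) (o : I.Dout),
      ProtoAlg.HaltsIn ⟨Al, G, I⟩ (.inp d) n o ↔ ProtoAlg.HaltsIn ⟨Al, G', I⟩ (.inp d) n o := by
    intro d n o
    have hs : c.spec.sol 𝔇 c.var (FVal.denote 𝔇 (ρ d)) =
        c'.spec.sol 𝔇 c'.var (FVal.denote 𝔇 (ρ d)) :=
      -- The assignment supplied here is immaterial: evaluation ignores it and starts from `ρ d`.
      congrFun (PDeriv.sound 𝔇 (h d)) (FVal.denote 𝔇 (ρ d))
    rw [hc.haltsIn_iff 𝔇 d (η := FVal.denote 𝔇 (ρ d)) (hρ d),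
      hc'.haltsIn_iff 𝔇 d (η := FVal.denote 𝔇 (ρ d)) (hρ d), hs]
  exact ⟨ProtoAlg.algSimulated_of_haltsIn key,
    ProtoAlg.algSimulated_of_haltsIn fun d n o => (key d n o).symm⟩
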